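/- Throughout, algorithms run on a word RAM with signed $w$-bit words: registers, a memory of words, unit-cost arithmetic on words, comparisons, and indirect loads and stores, with no intermediate value allowed to overflow a word. For $A \in \mathbb{Z}^{m\times n}$ let $\Delta = \|A\|_\infty$ be the largest absolute value of an entry of $A$ (and $0$ if $A$ has no entries), and for $y \in \mathbb{Z}_{\ge 0}^n$ let $\mathrm{supp}(y) = \{j : y_j \neq 0\}$, identified with its indicator vector in $\{0,1\}^n$. **Lemma (ILP solutions with small support).** There are a single program and an absolute constant $C$ with the following property. For all $m, n \ge 0$ and every matrix $A \in \mathbb{Z}^{m \times n}$ there is a set $\mathcal{X} \subseteq \{0,1\}^n$ such that: 1. Given $m$, $n$ and the entries of $A$, the program halts after at most $T$ steps and outputs an explicit list of the elements of $\mathcal{X}$, where $T = (n\Delta)^{C m}$ if $m \ge 1$ and $n\Delta \ge 2$, and $T = (n+2)^{C(m+1)}$ in the remaining degenerate cases ($m = 0$ or $n\Delta \le 1$). This holds for every word length $w \ge \log_2 T$, with the same set $\mathcal{X}$. 2. For every target vector $b \in \mathbb{Z}^m$ for which there is an $x \in \mathbb{Z}_{\ge 0}^n$ with $Ax = b$,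 there is a $y \in \mathbb{Z}_{\ge 0}^n$ with $$Ay = b, \qquad \mathrm{supp}(y) \in \mathcal{X}, \qquad |\mathrm{supp}(y)| \le m \log_2(2n\Delta + 1).$$ -/

import Mathlib

/-!
A word RAM with an explicit step count, and the vocabulary of integer programs.
-/

namespace WordRAM

/-- The arithmetic operations on machine words. -/
inductive Op where
  | add
  | sub
  | mul
  | div
  | mod

/-- The comparisons of machine words that a branch or a loop may test. -/
inductive Cmp where
  | eq
  | ne
  | lt
  | le

/-- Elementary instructions; registers are named by natural numbers.
`const r c` is `r := c`, `copy r a` is `r := a`, `op o r a b` is `r := a o b`,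
`load r a` is `r := memory[a]`, and `store a b` is `memory[a] := b`. -/
inductive Instr where
  | const (r : ℕ) (c : ℤ)
  | copy (r a : ℕ)
  | op (o : Op) (r a b : ℕ)
  | load (r a : ℕ)
  | store (a b : ℕ)

/-- Programs: structured code over the elementary instructions. A test compares two registers. -/
inductive Prog where
  | nop
  | instr (i : Instr)
  | seq (p q : Prog)
  | branch (c : Cmp) (a b : ℕ) (p q : Prog)
  | loop (c : Cmp) (a b : ℕ) (p : Prog)

/-- The contents of the registers and of the memory cells. -/
structure State where
  reg : ℕ → ℤ
  mem : ℕ → ℤ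

/-- The result of an arithmetic operation, `none` for a division by zero. Division is
division with remainder `0 ≤ a mod b < |b|`. -/
def Op.eval : Op → ℤ → ℤ → Option ℤ
  | .add, a, b => some (a + b)
  | .sub, a, b => some (a - b)
  | .mul, a, b => some (a * b)
  | .div, a, b => if b = 0 then none else some (a / b)
  | .mod, a, b => if b = 0 then none else some (a % b)

/-- The truth value of a comparison. -/
def Cmp.Holds : Cmp → ℤ → ℤ → Prop
  | .eq, a, b => a = b
  | .ne, a, b => a ≠ b
  | .lt, a, b => a < b
  | .le, a, b => a ≤ b

/-- `v` fits into a signed (two's complement) machine word of `w` bits: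
`-2 ^ (w - 1) ≤ v < 2 ^ (w - 1)`, and `v = 0` for `w = 0`. -/
abbrev IsWord (w : ℕ) (v : ℤ) : Prop := -(2 ^ w) ≤ 2 * v ∧ 2 * v < 2 ^ w

/-- Write `v` into register `r`; the machine faults if `v` overflows the word length `w`. -/
def State.setReg (w : ℕ) (s : State) (r : ℕ) (v : ℤ) : Option State :=
  if IsWord w v then some { s with reg := Function.update s.reg r v } else none

/-- The effect of one elementary instruction on a machine with `w`-bit words; `none` is a fault
(overflow, division by zero, or a negative address). -/
def Instr.run (w : ℕ) : Instr → State → Option State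
  | .const r c, s => s.setReg w r c
  | .copy r a, s => s.setReg w r (s.reg a)
  | .op o r a b, s => (o.eval (s.reg a) (s.reg b)).bind (s.setReg w r)
  | .load r a, s => if 0 ≤ s.reg a then s.setReg w r (s.mem (s.reg a).toNat) else none
  | .store a b, s =>
      if 0 ≤ s.reg a ∧ IsWord w (s.reg b) then
        some { s with mem := Function.update s.mem (s.reg a).toNat (s.reg b) }
      else none

/-- `Exec w p s s' t`: on a machine with `w`-bit words, the program `p` started in the state `s`
halts without a fault in the state `s'` after exactly `t` steps. Every elementary instruction and
every evaluation of a test is one step. -/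
inductive Exec (w : ℕ) : Prog → State → State → ℕ → Prop where
  | nop (s : State) : Exec w .nop s s 1
  | instr {i : Instr} {s s' : State} (h : i.run w s = some s') : Exec w (.instr i) s s' 1
  | seq {p q : Prog} {s s' s'' : State} {t t' : ℕ}
      (hp : Exec w p s s' t) (hq : Exec w q s' s'' t') : Exec w (.seq p q) s s'' (t + t')
  | branch_true {c : Cmp} {a b : ℕ} {p q : Prog} {s s' : State} {t : ℕ}
      (hc : c.Holds (s.reg a) (s.reg b)) (hp : Exec w p s s' t) :
      Exec w (.branch c a b p q) s s' (t + 1)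
  | branch_false {c : Cmp} {a b : ℕ} {p q : Prog} {s s' : State} {t : ℕ}
      (hc : ¬ c.Holds (s.reg a) (s.reg b)) (hq : Exec w q s s' t) :
      Exec w (.branch c a b p q) s s' (t + 1)
  | loop_done {c : Cmp} {a b : ℕ} {p : Prog} {s : State}
      (hc : ¬ c.Holds (s.reg a) (s.reg b)) : Exec w (.loop c a b p) s s 1
  | loop_step {c : Cmp} {a b : ℕ} {p : Prog} {s s' s'' : State} {t t' : ℕ}
      (hc : c.Holds (s.reg a) (s.reg b)) (hp : Exec w p s s' t)
      (hl : Exec w (.loop c a b p) s' s'' t') : Exec w (.loop c a b p) s s'' (t + t' + 1)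

/-- The initial state on the input `A ∈ ℤ^{m × n}`: register `0` holds `m`, register `1` holds `n`,
the cells `0, …, m n - 1` hold the entries of `A` row by row, everything else is `0`. -/
def input {m n : ℕ} (A : Matrix (Fin m) (Fin n) ℤ) : State where
  reg r := if r = 0 then (m : ℤ) else if r = 1 then (n : ℤ) else 0
  mem k := if h : k < m * n then
      A (finProdFinEquiv.symm ⟨k, h⟩).1 (finProdFinEquiv.symm ⟨k, h⟩).2
    else 0

/-- In the state `s` the machine outputs the set `X` of vectors of length `n`: register `0` holds
the length `k` of a list of vectors, register `1` the address `p` of the list, and the `t`-th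
vector occupies the `n` consecutive cells from `p + t n` on. `X` is the set of listed vectors. -/
def Outputs {n : ℕ} (s : State) (X : Set (Fin n → ℤ)) : Prop :=
  ∃ k p : ℕ, s.reg 0 = k ∧ s.reg 1 = p ∧
    X = {x | ∃ t < k, ∀ j : Fin n, x j = s.mem (p + t * n + j)}

end WordRAM

/-- `‖A‖_∞`, the largest absolute value of an entry of `A` (`0` if there is no entry). -/
def maxAbsEntry {m n : ℕ} (A : Matrix (Fin m) (Fin n) ℤ) : ℕ :=
  Finset.univ.sup fun i => Finset.univ.sup fun j => (A i j).natAbs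

/-- The support of `y`. -/
def vecSupp {n : ℕ} (y : Fin n → ℕ) : Finset (Fin n) :=
  Finset.univ.filter fun j => y j ≠ 0

/-- The support of `y` as a vector in `{0,1}^n`. -/
def suppVec {n : ℕ} (y : Fin n → ℕ) : Fin n → ℤ :=
  fun j => if j ∈ vecSupp y then 1 else 0

/-- The bound `(n Δ)^{C m}`. In the degenerate cases `m = 0` or `n Δ ≤ 1`, where this power is
`0` or `1`, it is replaced by `(n + 2)^{C (m + 1)}`. -/
def powBound (C m n Δ : ℕ) : ℕ :=
  if 1 ≤ m ∧ 2 ≤ n * Δ then (n * Δ) ^ (C * m) else (n + 2) ^ (C * (m + 1))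

/-! ### Candidate supports with pairwise distinct images -/

namespace SmallSupport

open Function

variable {m n : ℕ}

/-! The candidates are built column by column. A list of `0/1`-vectors with pairwise distinct images
under `A` is maintained, starting from the zero vector. For column `j`, each vector `x` of the old
list yields the candidate `x + e_j`, which is appended only if its image is new. Images of
`0/1`-vectors lie in a box with `(2nΔ + 1)^m` integer points, so the list never exceeds this length,
although it is drawn from `2^n` vectors.

Discarding repeated images is harmless because of a tie-breaking rule. Give `y` the weight `∑ 2^i
y_i` and choose, among the nonnegative integer solutions of `Ay = b`, one of least weight. Being
lightest passes to every integer vector `0 ≤ u ≤ y`: a lighter replacement of `u` would give a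
lighter replacement of `y` (`IsLightest.of_le`). A lightest `0/1`-vector is never lost
(`IsLightest.mem_stage`): one using column `j` weighs at least `2^j`, more than any candidate from
earlier columns, so it cannot share its image with an older one. Hence the indicators of all subsets
of `supp(y)` are listed. This gives membership of the support and also its size: these `2^|supp(y)|`
indicators have distinct images in the box, so `2^|supp(y)| ≤ (2nΔ + 1)^m`.

On the word RAM, each candidate is compared with every listed vector by inner products with the rows
of `A`. With `M = (2nΔ + 1)^m`, time and all numbers that occur are bounded by a constant times `(n
+ 1)^2 (m + 1) M^2`, which `resourceBound_le_powBound` absorbs into the required power. -/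

/-- Append `x` with its `j`-th coordinate set to `1`, unless its image under `A` already occurs. -/
def extend (A : Matrix (Fin m) (Fin n) ℤ) (j : Fin n) (L : List (Fin n → ℤ)) (x : Fin n → ℤ) :
    List (Fin n → ℤ) :=
  if ∃ y ∈ L, A.mulVec y = A.mulVec (update x j 1) then L else L ++ [update x j 1]

/-- The candidate supports contained in the first `j` columns. -/
def stage (A : Matrix (Fin m) (Fin n) ℤ) : ℕ → List (Fin n → ℤ)
  | 0 => [0]
  | j + 1 => if h : j < n then (stage A j).foldl (extend A ⟨j, h⟩) (stage A j) else stage A j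

/-- No two members of the list have the same image under `A`. -/
def DistinctImages (A : Matrix (Fin m) (Fin n) ℤ) (L : List (Fin n → ℤ)) : Prop :=
  (L.map A.mulVec).Nodup

/-- All members of the list are `0/1`-vectors. -/
def ZeroOne (L : List (Fin n → ℤ)) : Prop := ∀ x ∈ L, ∀ j, x j = 0 ∨ x j = 1

lemma DistinctImages.eq {A : Matrix (Fin m) (Fin n) ℤ} {L : List (Fin n → ℤ)}
    (h : DistinctImages A L) {x y : Fin n → ℤ} (hx : x ∈ L) (hy : y ∈ L)
    (hxy : A.mulVec x = A.mulVec y) : x = y :=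
  List.inj_on_of_nodup_map h hx hy hxy

lemma prefix_extend (A : Matrix (Fin m) (Fin n) ℤ) (j : Fin n) (L : List (Fin n → ℤ))
    (x : Fin n → ℤ) : L <+: extend A j L x := by
  unfold extend
  split_ifs
  · exact List.prefix_rfl
  · exact List.prefix_append _ _

lemma mem_extend {A : Matrix (Fin m) (Fin n) ℤ} {j : Fin n} {L : List (Fin n → ℤ)}
    {x y : Fin n → ℤ} (h : y ∈ extend A j L x) : y ∈ L ∨ y = update x j 1 := by
  unfold extend at h
  split_ifs at h
  · exact Or.inl h
  · simpa using h

lemma exists_mem_extend (A : Matrix (Fin m) (Fin n) ℤ) (j : Fin n) (L : List (Fin n → ℤ))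
    (x : Fin n → ℤ) : ∃ y ∈ extend A j L x, A.mulVec y = A.mulVec (update x j 1) := by
  unfold extend
  split_ifs with h
  · exact h
  · exact ⟨_, by simp, rfl⟩

lemma DistinctImages.extend {A : Matrix (Fin m) (Fin n) ℤ} {L : List (Fin n → ℤ)}
    (h : DistinctImages A L) (j : Fin n) (x : Fin n → ℤ) :
    DistinctImages A (extend A j L x) := by
  unfold SmallSupport.extend
  split_ifs with hx
  · exact h
  · unfold DistinctImages at h ⊢
    rw [List.map_append, List.nodup_append]
    refine ⟨h, by simp, ?_⟩
    intro a ha b hb hab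
    obtain ⟨y, hy, rfl⟩ := List.mem_map.1 ha
    simp only [List.map_cons, List.map_nil, List.mem_singleton] at hb
    exact hx ⟨y, hy, hab.trans hb⟩

lemma prefix_foldl_extend (A : Matrix (Fin m) (Fin n) ℤ) (j : Fin n) (M L : List (Fin n → ℤ)) :
    L <+: M.foldl (extend A j) L := by
  induction M generalizing L with
  | nil => exact List.prefix_rfl
  | cons x M ih => exact (prefix_extend A j L x).trans (ih _)

lemma mem_foldl_extend {A : Matrix (Fin m) (Fin n) ℤ} {j : Fin n} {M L : List (Fin n → ℤ)}
    {y : Fin n → ℤ} (h : y ∈ M.foldl (extend A j) L) :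
    y ∈ L ∨ ∃ x ∈ M, y = update x j 1 := by
  induction M generalizing L with
  | nil => exact Or.inl h
  | cons x M ih =>
    rcases ih h with h | ⟨z, hz, rfl⟩
    · rcases mem_extend h with h | rfl
      · exact Or.inl h
      · exact Or.inr ⟨x, by simp, rfl⟩
    · exact Or.inr ⟨z, by simp [hz], rfl⟩

/-- A candidate may be discarded, but its image never is: either it was appended or its image was
already present, and later steps only lengthen the list. -/
lemma exists_mem_foldl_extend (A : Matrix (Fin m) (Fin n) ℤ) (j : Fin n)
    (M L : List (Fin n → ℤ)) {x : Fin n → ℤ} (hx : x ∈ M) :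
    ∃ y ∈ M.foldl (extend A j) L, A.mulVec y = A.mulVec (update x j 1) := by
  induction M generalizing L with
  | nil => simp at hx
  | cons z M ih =>
    rcases List.mem_cons.1 hx with rfl | hx
    · obtain ⟨y, hy, h⟩ := exists_mem_extend A j L x
      exact ⟨y, (prefix_foldl_extend A j M _).subset hy, h⟩
    · exact ih _ hx

lemma DistinctImages.foldl_extend {A : Matrix (Fin m) (Fin n) ℤ} {L : List (Fin n → ℤ)}
    (h : DistinctImages A L) (j : Fin n) (M : List (Fin n → ℤ)) :
    DistinctImages A (M.foldl (SmallSupport.extend A j) L) := by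
  induction M generalizing L with
  | nil => exact h
  | cons x M ih => exact ih (h.extend j x)

lemma ZeroOne.foldl_extend {A : Matrix (Fin m) (Fin n) ℤ} {L M : List (Fin n → ℤ)}
    (hL : ZeroOne L) (hM : ZeroOne M) (j : Fin n) :
    ZeroOne (M.foldl (SmallSupport.extend A j) L) := by
  intro y hy i
  rcases mem_foldl_extend hy with hy | ⟨x, hx, rfl⟩
  · exact hL y hy i
  · rcases eq_or_ne i j with rfl | hij
    · simp
    · simpa [hij] using hM x hx i

lemma distinctImages_stage (A : Matrix (Fin m) (Fin n) ℤ) (j : ℕ) :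
    DistinctImages A (stage A j) := by
  induction j with
  | zero => simp [stage, DistinctImages]
  | succ j ih =>
    rw [stage]
    split_ifs
    · exact ih.foldl_extend _ _
    · exact ih

lemma zeroOne_stage (A : Matrix (Fin m) (Fin n) ℤ) (j : ℕ) : ZeroOne (stage A j) := by
  induction j with
  | zero => simp [stage, ZeroOne]
  | succ j ih =>
    rw [stage]
    split_ifs
    · exact ih.foldl_extend ih _
    · exact ih

lemma eq_zero_of_mem_stage {A : Matrix (Fin m) (Fin n) ℤ} {j : ℕ} {x : Fin n → ℤ}
    (hx : x ∈ stage A j) (i : Fin n) (hi : j ≤ i) : x i = 0 := by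
  induction j generalizing x with
  | zero => simp_all [stage]
  | succ j ih =>
    rw [stage] at hx
    split_ifs at hx with h
    · rcases mem_foldl_extend hx with hx | ⟨z, hz, rfl⟩
      · exact ih hx (by omega)
      · rw [update_of_ne (by rintro rfl; simp at hi)]
        exact ih hz (by omega)
    · exact ih hx (by omega)

/-! ### Vectors of least weight survive -/

/-- The weight of a vector; among `0/1`-vectors it is a total order. -/
def weight (x : Fin n → ℤ) : ℤ := ∑ i : Fin n, 2 ^ (i : ℕ) * x i

lemma weight_add (x y : Fin n → ℤ) : weight (x + y) = weight x + weight y := by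
  simp [weight, mul_add, Finset.sum_add_distrib]

lemma weight_nonneg {x : Fin n → ℤ} (hx : 0 ≤ x) : 0 ≤ weight x :=
  Finset.sum_nonneg fun i _ => mul_nonneg (by positivity) (hx i)

/-- The geometric sum `1 + 2 + ⋯ + 2^(j-1) < 2^j`. Together with `two_pow_le_weight`, using column
`j` costs more than all earlier columns together. -/
lemma weight_lt_two_pow {x : Fin n → ℤ} {j : ℕ} (hx : ∀ i, x i = 0 ∨ x i = 1)
    (hj : ∀ i : Fin n, j ≤ i → x i = 0) : weight x < 2 ^ j := by
  have h1 : weight x ≤ ∑ i : Fin n, if (i : ℕ) < j then (2 : ℤ) ^ (i : ℕ) else 0 := by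
    refine Finset.sum_le_sum fun i _ => ?_
    split_ifs with h
    · rcases hx i with h | h <;> simp [h]
    · simp [hj i (by omega)]
  have h2 : ∑ i : Fin n, (if (i : ℕ) < j then (2 : ℤ) ^ (i : ℕ) else 0)
      ≤ ∑ i ∈ Finset.range j, (2 : ℤ) ^ i := by
    rw [Fin.sum_univ_eq_sum_range (fun i => if i < j then (2 : ℤ) ^ i else 0) n,
      ← Finset.sum_filter]
    refine Finset.sum_le_sum_of_subset_of_nonneg ?_ fun _ _ _ => by positivity
    intro i hi
    simp at hi ⊢
    exact hi.2
  have h3 : ∑ i ∈ Finset.range j, (2 : ℤ) ^ i < 2 ^ j := by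
    have := mul_geom_sum (2 : ℤ) j
    linarith
  linarith

lemma two_pow_le_weight {x : Fin n → ℤ} (hx : 0 ≤ x) {j : Fin n} (hj : x j = 1) :
    2 ^ (j : ℕ) ≤ weight x := by
  have := Finset.single_le_sum (f := fun i : Fin n => 2 ^ (i : ℕ) * x i)
    (fun i _ => mul_nonneg (by positivity) (hx i)) (Finset.mem_univ j)
  simp only [hj, mul_one] at this
  exact this

/-- `x` has least weight among the nonnegative vectors with the same image under `A`. -/
def IsLightest (A : Matrix (Fin m) (Fin n) ℤ) (x : Fin n → ℤ) : Prop :=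
  ∀ z, 0 ≤ z → A.mulVec z = A.mulVec x → weight x ≤ weight z

/-- Exchange argument: if `z` has the image of `u`, then `z + (x - u)` is nonnegative with the image
of `x`, and weights are additive. -/
lemma IsLightest.of_le {A : Matrix (Fin m) (Fin n) ℤ} {x u : Fin n → ℤ} (h : IsLightest A x)
    (hux : u ≤ x) : IsLightest A u := by
  intro z hz hA
  have h1 := h (z + (x - u)) (add_nonneg hz (sub_nonneg.2 hux)) (by
    rw [Matrix.mulVec_add, Matrix.mulVec_sub, hA, add_sub_cancel])
  have h2 := weight_add u (x - u)
  rw [add_sub_cancel] at h2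
  rw [weight_add] at h1
  linarith

/-- Induction on the columns. If `x` uses the last column, removing it leaves a lightest vector `u`,
listed by induction; what remains is to see that the candidate made from `u` is the one that
represents its image. -/
lemma IsLightest.mem_stage {A : Matrix (Fin m) (Fin n) ℤ} {x : Fin n → ℤ} (h : IsLightest A x)
    (hx : ∀ i, x i = 0 ∨ x i = 1) {j : ℕ} (hj : ∀ i : Fin n, j ≤ i → x i = 0) :
    x ∈ stage A j := by
  induction j generalizing x with
  | zero =>
    simp only [stage, List.mem_singleton]
    exact funext fun i => hj i (Nat.zero_le _)
  | succ j ih =>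
    rw [stage]
    split_ifs with hjn
    · have hx0 : 0 ≤ x := fun i => by rcases hx i with h | h <;> simp [h]
      rcases hx ⟨j, hjn⟩ with h0 | h1
      · refine (prefix_foldl_extend _ _ _ _).subset (ih h hx fun i hi => ?_)
        rcases hi.eq_or_lt with hi | hi
        · rw [← h0]; congr; exact Fin.ext hi.symm
        · exact hj i hi
      · set u := update x ⟨j, hjn⟩ 0 with hu
        have hxu : update u ⟨j, hjn⟩ 1 = x := by rw [hu, update_idem, ← h1, update_eq_self]
        have hmem : u ∈ stage A j := by
          refine ih (h.of_le ?_) ?_ ?_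
          · rw [hu, update_le_iff]
            exact ⟨by simp [h1], fun _ _ => le_rfl⟩
          · intro i
            rcases eq_or_ne i ⟨j, hjn⟩ with rfl | hi
            · simp [hu]
            · simpa [hu, hi] using hx i
          · intro i hi
            rcases hi.eq_or_lt with hi | hi
            · obtain rfl : i = ⟨j, hjn⟩ := Fin.ext hi.symm
              simp [hu]
            · have : i ≠ ⟨j, hjn⟩ := by rintro rfl; simp at hi
              simpa [hu, this] using hj i hi
        obtain ⟨y, hy, hAy⟩ := exists_mem_foldl_extend A ⟨j, hjn⟩ (stage A j) (stage A j) hmem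
        rw [hxu] at hAy
        -- An older representative would be lighter than `x`. A representative built in this round
        -- comes from some `z` with the same image as `u`, so `z = u` by distinctness in the
        -- previous stage.
        rcases mem_foldl_extend hy with hy' | ⟨z, hz, rfl⟩
        · have hy01 := zeroOne_stage A j y hy'
          have h2 := weight_lt_two_pow hy01 (eq_zero_of_mem_stage hy')
          have h3 := two_pow_le_weight hx0 h1
          have h4 := h y (fun i => by rcases hy01 i with h | h <;> simp [h]) hAy
          simp only at h3
          linarith
        · have hsplit : ∀ v : Fin n → ℤ, v ⟨j, hjn⟩ = 0 →
              update v ⟨j, hjn⟩ 1 = v + Pi.single ⟨j, hjn⟩ 1 := by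
            intro v hv
            ext i
            rcases eq_or_ne i ⟨j, hjn⟩ with rfl | hi
            · simp [hv]
            · simp [hi]
          rw [← hxu, hsplit z (eq_zero_of_mem_stage hz _ le_rfl),
            hsplit u (by simp [hu]), Matrix.mulVec_add, Matrix.mulVec_add] at hAy
          have := (distinctImages_stage A j).eq hz hmem (add_right_cancel hAy)
          rwa [this, hxu] at hy
    · refine ih h hx fun i _ => absurd i.2 (by omega)

/-! ### Counting images, and the size of the support -/

lemma natAbs_le_maxAbsEntry (A : Matrix (Fin m) (Fin n) ℤ) (i : Fin m) (j : Fin n) :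
    (A i j).natAbs ≤ maxAbsEntry A :=
  (Finset.le_sup (f := fun j => (A i j).natAbs) (Finset.mem_univ j)).trans
    (Finset.le_sup (f := fun i => Finset.univ.sup fun j => (A i j).natAbs) (Finset.mem_univ i))

lemma abs_le_maxAbsEntry (A : Matrix (Fin m) (Fin n) ℤ) (i : Fin m) (j : Fin n) :
    |A i j| ≤ maxAbsEntry A := by
  rw [Int.abs_eq_natAbs]
  exact_mod_cast natAbs_le_maxAbsEntry A i j

/-- The box that contains the images of all `0/1`-vectors. -/
noncomputable def imageBox (A : Matrix (Fin m) (Fin n) ℤ) : Finset (Fin m → ℤ) :=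
  Fintype.piFinset fun _ => Finset.Icc (-(n * maxAbsEntry A : ℤ)) (n * maxAbsEntry A)

lemma card_imageBox (A : Matrix (Fin m) (Fin n) ℤ) :
    (imageBox A).card = (2 * (n * maxAbsEntry A) + 1) ^ m := by
  simp only [imageBox, Fintype.card_piFinset, Int.card_Icc, Finset.prod_const, Finset.card_univ,
    Fintype.card_fin]
  congr 1
  omega

lemma mulVec_mem_imageBox (A : Matrix (Fin m) (Fin n) ℤ) {x : Fin n → ℤ}
    (hx : ∀ i, x i = 0 ∨ x i = 1) : A.mulVec x ∈ imageBox A := by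
  simp only [imageBox, Fintype.mem_piFinset, Finset.mem_Icc, ← abs_le]
  intro i
  refine (Finset.abs_sum_le_sum_abs (fun l => A i l * x l) Finset.univ).trans ?_
  have : ∀ l ∈ Finset.univ, |A i l * x l| ≤ maxAbsEntry A := fun l _ => by
    have := abs_le_maxAbsEntry A i l
    rcases hx l with h | h <;> simp [h, this]
  simpa using Finset.sum_le_card_nsmul _ _ _ this

lemma DistinctImages.length_le {A : Matrix (Fin m) (Fin n) ℤ} {L : List (Fin n → ℤ)}
    (h : DistinctImages A L) (h01 : ZeroOne L) :
    L.length ≤ (2 * (n * maxAbsEntry A) + 1) ^ m := by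
  rw [← card_imageBox, ← List.length_map A.mulVec, ← List.toFinset_card_of_nodup h]
  refine Finset.card_le_card fun v hv => ?_
  obtain ⟨x, hx, rfl⟩ := List.mem_map.1 (List.mem_toFinset.1 hv)
  exact mulVec_mem_imageBox A (h01 x hx)

/-- The indicator vector of a set of columns. -/
def indicator (S : Finset (Fin n)) : Fin n → ℤ := fun j => if j ∈ S then 1 else 0

lemma indicator_eq_zero_or_one (S : Finset (Fin n)) (i : Fin n) :
    indicator S i = 0 ∨ indicator S i = 1 := by
  unfold indicator
  split_ifs <;> simp

lemma indicator_injective : Injective (indicator : Finset (Fin n) → Fin n → ℤ) := by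
  intro S T h
  ext i
  have := congrFun h i
  unfold indicator at this
  split_ifs at this <;> simp_all

lemma IsLightest.indicator_mem_stage {A : Matrix (Fin m) (Fin n) ℤ} {y : Fin n → ℕ}
    (h : IsLightest A fun j => (y j : ℤ)) {T : Finset (Fin n)} (hT : T ⊆ vecSupp y) :
    indicator T ∈ stage A n := by
  refine (h.of_le (u := indicator T) fun i => ?_).mem_stage (indicator_eq_zero_or_one T)
    fun i hi => absurd i.2 (by omega)
  unfold indicator
  split_ifs with hi
  · have := hT hi
    simp only [vecSupp, Finset.mem_filter] at this
    have := this.2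
    simp only
    omega
  · simp

/-- The indicators of all subsets of the support are listed, and listed vectors have distinct
images; so the power set of the support injects into the box. -/
lemma IsLightest.two_pow_card_le {A : Matrix (Fin m) (Fin n) ℤ} {y : Fin n → ℕ}
    (h : IsLightest A fun j => (y j : ℤ)) :
    2 ^ (vecSupp y).card ≤ (2 * (n * maxAbsEntry A) + 1) ^ m := by
  rw [← card_imageBox, ← Finset.card_powerset]
  refine Finset.card_le_card_of_injOn (fun T => A.mulVec (indicator T)) ?_ ?_
  · exact fun T _ => mulVec_mem_imageBox A (indicator_eq_zero_or_one T)
  · intro S hS T hT hST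
    exact indicator_injective ((distinctImages_stage A n).eq
      (h.indicator_mem_stage (Finset.mem_powerset.1 hS))
      (h.indicator_mem_stage (Finset.mem_powerset.1 hT)) hST)

lemma exists_isLightest (A : Matrix (Fin m) (Fin n) ℤ) (x : Fin n → ℕ) :
    ∃ y : Fin n → ℕ, A.mulVec (fun j => (y j : ℤ)) = A.mulVec (fun j => (x j : ℤ)) ∧
      IsLightest A fun j => (y j : ℤ) := by
  obtain ⟨y, hy, hmin⟩ := exists_minimalFor_of_wellFoundedLT
    (fun y : Fin n → ℕ => A.mulVec (fun j => (y j : ℤ)) = A.mulVec (fun j => (x j : ℤ)))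
    (fun y => (weight fun j => (y j : ℤ)).toNat) ⟨x, rfl⟩
  refine ⟨y, hy, fun z hz hA => ?_⟩
  have hz' : (fun j => ((z j).toNat : ℤ)) = z := funext fun j => Int.toNat_of_nonneg (hz j)
  -- Minimality was taken over natural vectors, where weights are well-founded; a nonnegative
  -- integer competitor is read as one of these.
  have h1 := hmin (j := fun j => (z j).toNat) (by simp only [hz']; exact hA.trans hy)
  simp only [hz'] at h1
  have h2 : 0 ≤ weight fun j => (y j : ℤ) := weight_nonneg fun j => by simp
  have h3 := weight_nonneg hz
  by_contra! hlt
  have := h1 (by omega)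
  omega

theorem exists_solution (A : Matrix (Fin m) (Fin n) ℤ) (x : Fin n → ℕ) :
    ∃ y : Fin n → ℕ, A.mulVec (fun j => (y j : ℤ)) = A.mulVec (fun j => (x j : ℤ)) ∧
      suppVec y ∈ stage A n ∧
      ((vecSupp y).card : ℝ) ≤ m * Real.logb 2 (2 * n * maxAbsEntry A + 1) := by
  obtain ⟨y, hy, h⟩ := exists_isLightest A x
  refine ⟨y, hy, h.indicator_mem_stage subset_rfl, ?_⟩
  have h1 : (2 : ℝ) ^ (vecSupp y).card ≤ (2 * n * maxAbsEntry A + 1) ^ m := by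
    have := h.two_pow_card_le
    rw [← mul_assoc] at this
    exact_mod_cast this
  have h2 := Real.logb_le_logb_of_le one_lt_two (by positivity) h1
  rwa [Real.logb_pow, Real.logb_pow, Real.logb_self_eq_one one_lt_two, mul_one] at h2

end SmallSupport

namespace WordRAM

open Function

/-! ### Rules for time-bounded execution -/

/-- On a machine with `w`-bit words, `p` started in `s` halts within `T` steps in a state
that satisfies `Q`. -/
def Runs (w : ℕ) (p : Prog) (s : State) (T : ℕ) (Q : State → Prop) : Prop :=
  ∃ s' t, Exec w p s s' t ∧ t ≤ T ∧ Q s'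

lemma Runs.mono {w : ℕ} {p : Prog} {s : State} {T T' : ℕ} {Q Q' : State → Prop}
    (h : Runs w p s T Q) (hT : T ≤ T') (hQ : ∀ s', Q s' → Q' s') : Runs w p s T' Q' := by
  obtain ⟨s', t, he, ht, hq⟩ := h
  exact ⟨s', t, he, ht.trans hT, hQ s' hq⟩

lemma Runs.seq {w : ℕ} {p q : Prog} {s : State} {T T' : ℕ} {Q R : State → Prop}
    (hp : Runs w p s T Q) (hq : ∀ s', Q s' → Runs w q s' T' R) :
    Runs w (.seq p q) s (T + T') R := by
  obtain ⟨s', t, he, ht, h⟩ := hp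
  obtain ⟨s'', t', he', ht', h'⟩ := hq s' h
  exact ⟨s'', t + t', .seq he he', add_le_add ht ht', h'⟩

lemma Runs.branch {w : ℕ} {c : Cmp} {a b : ℕ} {p q : Prog} {s : State} {T : ℕ}
    {Q : State → Prop} (hp : c.Holds (s.reg a) (s.reg b) → Runs w p s T Q)
    (hq : ¬ c.Holds (s.reg a) (s.reg b) → Runs w q s T Q) :
    Runs w (.branch c a b p q) s (T + 1) Q := by
  by_cases hc : c.Holds (s.reg a) (s.reg b)
  · obtain ⟨s', t, he, ht, h⟩ := hp hc
    exact ⟨s', t + 1, .branch_true hc he, by omega, h⟩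
  · obtain ⟨s', t, he, ht, h⟩ := hq hc
    exact ⟨s', t + 1, .branch_false hc he, by omega, h⟩

/-- A loop that runs `N` times, with the invariant `I i` after `i` rounds. -/
lemma Runs.loop {w : ℕ} {c : Cmp} {a b : ℕ} {p : Prog} {s : State} {N T : ℕ}
    (I : ℕ → State → Prop) (h0 : I 0 s)
    (hI : ∀ i s, i ≤ N → I i s → (c.Holds (s.reg a) (s.reg b) ↔ i < N))
    (hstep : ∀ i s, i < N → I i s → Runs w p s T (I (i + 1))) :
    Runs w (.loop c a b p) s (N * (T + 1) + 1) (I N) := by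
  -- Induction on the number `d` of remaining rounds; each round costs its body and one test, and
  -- the final failing test accounts for the extra `1`.
  suffices H : ∀ d i s, i + d = N → I i s →
      Runs w (.loop c a b p) s (d * (T + 1) + 1) (I N) from H N 0 s (by omega) h0
  intro d
  induction d with
  | zero =>
    rintro i s rfl h
    exact ⟨s, 1, .loop_done ((hI i s le_rfl h).not.2 (by omega)), by omega, h⟩
  | succ d ih =>
    intro i s hd h
    obtain ⟨s', t, he, ht, h'⟩ := hstep i s (by omega) h
    obtain ⟨s'', t', he', ht', h''⟩ := ih (i + 1) s' (by omega) h'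
    refine ⟨s'', t + t' + 1, .loop_step ((hI i s (by omega) h).2 (by omega)) he he', ?_, h''⟩
    rw [add_mul, one_mul]
    omega

/-- Write `v` into register `r`. -/
def State.set (s : State) (r : ℕ) (v : ℤ) : State := { s with reg := update s.reg r v }

/-- Write `v` into the memory cell `x`. -/
def State.write (s : State) (x : ℕ) (v : ℤ) : State := { s with mem := update s.mem x v }

@[simp] lemma State.set_mem (s : State) (r : ℕ) (v : ℤ) : (s.set r v).mem = s.mem := rfl

@[simp] lemma State.write_reg (s : State) (x : ℕ) (v : ℤ) : (s.write x v).reg = s.reg := rfl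

@[simp] lemma State.set_reg_self (s : State) (r : ℕ) (v : ℤ) : (s.set r v).reg r = v := by
  simp [State.set]

lemma State.set_reg_of_ne (s : State) {r r' : ℕ} (v : ℤ) (h : r' ≠ r) :
    (s.set r v).reg r' = s.reg r' := by
  simp [State.set, h]

lemma State.set_reg (s : State) (r r' : ℕ) (v : ℤ) :
    (s.set r v).reg r' = if r' = r then v else s.reg r' := by
  simp [State.set, update_apply]

lemma State.write_mem (s : State) (x x' : ℕ) (v : ℤ) :
    (s.write x v).mem x' = if x' = x then v else s.mem x' := by
  simp [State.write, update_apply]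

/-- Overflow checks are all reduced to one uniform magnitude bound `B`. -/
lemma isWord_of_abs_le {w B : ℕ} (hB : 2 * B < 2 ^ w) {v : ℤ} (hv : |v| ≤ B) : IsWord w v := by
  have h : (2 * B : ℤ) < 2 ^ w := by exact_mod_cast hB
  have := abs_le.1 hv
  constructor <;> linarith

lemma State.setReg_eq {w B : ℕ} (hB : 2 * B < 2 ^ w) (s : State) (r : ℕ) {v : ℤ}
    (hv : |v| ≤ B) : s.setReg w r v = some (s.set r v) := by
  rw [State.setReg, if_pos (isWord_of_abs_le hB hv), State.set]

lemma Runs.nop {w : ℕ} {s : State} {Q : State → Prop} (h : Q s) : Runs w .nop s 1 Q :=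
  ⟨s, 1, .nop s, le_rfl, h⟩

lemma Runs.instr_seq {w : ℕ} {i : Instr} {p : Prog} {s s' : State} {T : ℕ} {Q : State → Prop}
    (hi : i.run w s = some s') (h : Runs w p s' T Q) : Runs w (.seq (.instr i) p) s (T + 1) Q := by
  obtain ⟨s'', t, he, ht, hq⟩ := h
  exact ⟨s'', 1 + t, .seq (.instr hi) he, by omega, hq⟩

lemma Runs.const {w B : ℕ} (hB : 2 * B < 2 ^ w) {s : State} {p : Prog} {T : ℕ}
    {Q : State → Prop} {r : ℕ} {c : ℤ} (hc : |c| ≤ B) (h : Runs w p (s.set r c) T Q) :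
    Runs w (.seq (.instr (.const r c)) p) s (T + 1) Q :=
  .instr_seq (by rw [Instr.run, State.setReg_eq hB _ _ hc]) h

lemma Runs.copy {w B : ℕ} (hB : 2 * B < 2 ^ w) {s : State} {p : Prog} {T : ℕ}
    {Q : State → Prop} {r a x : ℕ} (ha : s.reg a = x) (hx : x ≤ B)
    (h : Runs w p (s.set r x) T Q) : Runs w (.seq (.instr (.copy r a)) p) s (T + 1) Q :=
  .instr_seq (by rw [Instr.run, ha, State.setReg_eq hB _ _ (by simpa using hx)]) h

lemma Runs.add {w B : ℕ} (hB : 2 * B < 2 ^ w) {s : State} {p : Prog} {T : ℕ}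
    {Q : State → Prop} {r a b : ℕ} {x y : ℤ} (ha : s.reg a = x) (hb : s.reg b = y)
    (hx : |x + y| ≤ B) (h : Runs w p (s.set r (x + y)) T Q) :
    Runs w (.seq (.instr (.op .add r a b)) p) s (T + 1) Q :=
  .instr_seq (by rw [Instr.run, ha, hb, Op.eval, Option.bind_some, State.setReg_eq hB _ _ hx]) h

lemma Runs.add_nat {w B : ℕ} (hB : 2 * B < 2 ^ w) {s : State} {p : Prog} {T : ℕ}
    {Q : State → Prop} {r a b x y : ℕ} (ha : s.reg a = x) (hb : s.reg b = y)
    (hx : x + y ≤ B) (h : Runs w p (s.set r (x + y : ℕ)) T Q) :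
    Runs w (.seq (.instr (.op .add r a b)) p) s (T + 1) Q := by
  refine .add hB ha hb ?_ (by rwa [Nat.cast_add] at h)
  rw [← Nat.cast_add, Nat.abs_cast]
  exact_mod_cast hx

lemma Runs.sub {w B : ℕ} (hB : 2 * B < 2 ^ w) {s : State} {p : Prog} {T : ℕ}
    {Q : State → Prop} {r a b : ℕ} {x y : ℤ} (ha : s.reg a = x) (hb : s.reg b = y)
    (hx : |x - y| ≤ B) (h : Runs w p (s.set r (x - y)) T Q) :
    Runs w (.seq (.instr (.op .sub r a b)) p) s (T + 1) Q :=
  .instr_seq (by rw [Instr.run, ha, hb, Op.eval, Option.bind_some, State.setReg_eq hB _ _ hx]) h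

lemma Runs.mul {w B : ℕ} (hB : 2 * B < 2 ^ w) {s : State} {p : Prog} {T : ℕ}
    {Q : State → Prop} {r a b : ℕ} {x y : ℤ} (ha : s.reg a = x) (hb : s.reg b = y)
    (hx : |x * y| ≤ B) (h : Runs w p (s.set r (x * y)) T Q) :
    Runs w (.seq (.instr (.op .mul r a b)) p) s (T + 1) Q :=
  .instr_seq (by rw [Instr.run, ha, hb, Op.eval, Option.bind_some, State.setReg_eq hB _ _ hx]) h

lemma Runs.load {w B : ℕ} (hB : 2 * B < 2 ^ w) {s : State} {p : Prog} {T : ℕ}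
    {Q : State → Prop} {r a x : ℕ} (ha : s.reg a = x) (hx : |s.mem x| ≤ B)
    (h : Runs w p (s.set r (s.mem x)) T Q) :
    Runs w (.seq (.instr (.load r a)) p) s (T + 1) Q :=
  .instr_seq (by rw [Instr.run, ha, if_pos (Int.natCast_nonneg x), Int.toNat_natCast,
    State.setReg_eq hB _ _ hx]) h

lemma Runs.store {w B : ℕ} (hB : 2 * B < 2 ^ w) {s : State} {p : Prog} {T : ℕ}
    {Q : State → Prop} {a b x : ℕ} {v : ℤ} (ha : s.reg a = x) (hb : s.reg b = v) (hv : |v| ≤ B)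
    (h : Runs w p (s.write x v) T Q) :
    Runs w (.seq (.instr (.store a b)) p) s (T + 1) Q :=
  .instr_seq (by rw [Instr.run, ha, hb,
    if_pos ⟨Int.natCast_nonneg x, isWord_of_abs_le hB hv⟩, Int.toNat_natCast, State.write]) h

/-! ### Comparing images on the machine -/

/-- The inner product of the row at address `R` with the difference of the vectors at the
addresses `a` and `q`. -/
def dot (μ : ℕ → ℤ) (R a q n : ℕ) : ℤ :=
  ∑ l ∈ Finset.range n, μ (R + l) * (μ (a + l) - μ (q + l))

/-- One round of `dotProg`. -/
def dotBody : Prog :=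
  .seq (.instr (.op .add 19 15 17)) <| .seq (.instr (.load 19 19)) <|
  .seq (.instr (.op .add 20 12 17)) <| .seq (.instr (.load 20 20)) <|
  .seq (.instr (.op .add 21 6 17)) <| .seq (.instr (.load 21 21)) <|
  .seq (.instr (.op .sub 20 20 21)) <| .seq (.instr (.op .mul 19 19 20)) <|
  .seq (.instr (.op .add 18 18 19)) <| .seq (.instr (.op .add 17 17 4)) .nop

/-- Compute `dot` into register `18`. -/
def dotProg : Prog :=
  .seq (.instr (.const 17 0)) <| .seq (.instr (.const 18 0)) <| .loop .lt 17 1 dotBody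

lemma abs_dot_le {μ : ℕ → ℤ} {R a q n D : ℕ} (hD : ∀ l < n, |μ (R + l)| ≤ D)
    (ha : ∀ l < n, μ (a + l) = 0 ∨ μ (a + l) = 1)
    (hq : ∀ l < n, μ (q + l) = 0 ∨ μ (q + l) = 1) : |dot μ R a q n| ≤ (n * D : ℕ) := by
  refine (Finset.abs_sum_le_sum_abs _ _).trans ?_
  have : ∀ l ∈ Finset.range n, |μ (R + l) * (μ (a + l) - μ (q + l))| ≤ D := fun l hl => by
    have hl := Finset.mem_range.1 hl
    have := hD l hl
    rcases ha l hl with h | h <;> rcases hq l hl with h' | h' <;> simp [h, h', this]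
  simpa using Finset.sum_le_card_nsmul _ _ _ this

/-- Differences of `0/1`-entries lie in `{-1, 0, 1}`, so partial sums stay within `n * D` and cannot
overflow. Preservation of the registers below `17` lets the enclosing loops keep their data there;
the outer routines follow the same discipline with smaller thresholds. -/
lemma runs_dotProg {w B : ℕ} (hB : 2 * B < 2 ^ w) {s : State} {n R a q D : ℕ}
    (h1 : s.reg 1 = n) (h4 : s.reg 4 = 1) (h15 : s.reg 15 = R) (h12 : s.reg 12 = a)
    (h6 : s.reg 6 = q) (hD : ∀ l < n, |s.mem (R + l)| ≤ D)
    (ha : ∀ l < n, s.mem (a + l) = 0 ∨ s.mem (a + l) = 1)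
    (hq : ∀ l < n, s.mem (q + l) = 0 ∨ s.mem (q + l) = 1)
    (hnD : n * D ≤ B) (hRB : R + n ≤ B) (haB : a + n ≤ B) (hqB : q + n ≤ B) (h1B : 1 ≤ B) :
    Runs w dotProg s (n * 12 + 3) fun s' =>
      s'.mem = s.mem ∧ s'.reg 18 = dot s.mem R a q n ∧ ∀ r < 17, s'.reg r = s.reg r := by
  refine .const hB (by simp) (.const hB (by simp) ?_)
  refine (Runs.loop (N := n) (T := 11) (fun i s' => s'.reg 17 = i ∧ s'.mem = s.mem ∧
    s'.reg 18 = dot s.mem R a q i ∧ ∀ r < 17, s'.reg r = s.reg r) ?_ ?_ ?_).mono le_rfl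
    fun s' h => h.2
  · refine ⟨by simp [State.set_reg], rfl, by simp [dot], fun r hr => ?_⟩
    simp [State.set_reg, hr.ne, show r ≠ 18 by omega]
  · rintro i s' - ⟨h17, -, -, hf⟩
    simp [Cmp.Holds, h17, hf, h1]
  · rintro i s' hi ⟨h17, hmem, h18, hf⟩
    have hDB : (D : ℤ) ≤ B := by
      have : 1 * D ≤ n * D := Nat.mul_le_mul_right _ (by omega)
      exact_mod_cast (by omega : D ≤ B)
    have h1B' : (1 : ℤ) ≤ B := by exact_mod_cast h1B
    have hdot := abs_dot_le (fun l (hl : l < i + 1) => hD l (by omega))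
      (fun l hl => ha l (by omega)) (fun l hl => hq l (by omega))
    have hiD : (((i + 1) * D : ℕ) : ℤ) ≤ B := by
      have : (i + 1) * D ≤ n * D := Nat.mul_le_mul_right _ hi
      exact_mod_cast this.trans hnD
    have hD' := hD i hi
    have habs : ∀ {v : ℤ}, v = 0 ∨ v = 1 → |v| ≤ (B : ℤ) := by
      rintro v (rfl | rfl) <;> simp [h1B]
    refine .add_nat hB (x := R) (y := i) (by simp [hf, h15]) h17 (by omega) ?_
    refine .load hB (x := R + i) (by simp) (by simpa [hmem] using hD'.trans hDB) ?_
    refine .add_nat hB (x := a) (y := i) (by simp [State.set_reg, hf, h12])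
      (by simp [State.set_reg, h17]) (by omega) ?_
    refine .load hB (x := a + i) (by simp) (by simpa [hmem] using habs (ha i hi)) ?_
    refine .add_nat hB (x := q) (y := i) (by simp [State.set_reg, hf, h6])
      (by simp [State.set_reg, h17]) (by omega) ?_
    refine .load hB (x := q + i) (by simp) (by simpa [hmem] using habs (hq i hi)) ?_
    refine .sub hB (x := s.mem (a + i)) (y := s.mem (q + i)) (by simp [State.set_reg, hmem])
      (by simp [hmem]) ?_ ?_
    · rcases ha i hi with h | h <;> rcases hq i hi with h' | h' <;> simp [h, h'] <;> omega
    refine .mul hB (x := s.mem (R + i)) (y := s.mem (a + i) - s.mem (q + i))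
      (by simp [State.set_reg, hmem]) (by simp) ?_ ?_
    · have := hD'.trans hDB
      rcases ha i hi with h | h <;> rcases hq i hi with h' | h' <;> simp [h, h', this]
    refine .add hB (x := dot s.mem R a q i)
      (y := s.mem (R + i) * (s.mem (a + i) - s.mem (q + i)))
      (by simp [State.set_reg, h18]) (by simp) ?_ ?_
    · rw [dot, ← Finset.sum_range_succ (fun l => s.mem (R + l) * (s.mem (a + l) - s.mem (q + l)))]
      exact hdot.trans hiD
    refine .add_nat hB (x := i) (y := 1) (by simp [State.set_reg, h17])
      (by simp [State.set_reg, hf, h4]) (by omega) (.nop ?_)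
    refine ⟨by simp, by simp [hmem], ?_, fun r hr => ?_⟩
    · simp [State.set_reg, dot, Finset.sum_range_succ]
    · simp only [State.set_reg]
      iterate 10 rw [if_neg (by omega)]
      exact hf r hr

end WordRAM

namespace WordRAM

open Function

/-- One round of `rowsProg`. -/
def rowsBody : Prog :=
  .seq dotProg <|
  .seq (.branch .ne 18 3 (.seq (.instr (.const 16 1)) .nop) .nop) <|
  .seq (.instr (.op .add 15 15 1)) <| .seq (.instr (.op .add 14 14 4)) .nop

/-- Decide whether all rows have the same inner product with two vectors. -/
def rowsProg : Prog :=
  .seq (.instr (.const 14 0)) <| .seq (.instr (.const 15 0)) <| .seq (.instr (.const 16 0)) <|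
  .loop .lt 14 0 rowsBody

/-- The vectors at the addresses `a` and `q` have the same inner product with the first `i`
rows. -/
def SameImage (μ : ℕ → ℤ) (n a q i : ℕ) : Prop := ∀ r < i, dot μ (r * n) a q n = 0

lemma sameImage_succ {μ : ℕ → ℤ} {n a q i : ℕ} :
    SameImage μ n a q (i + 1) ↔ SameImage μ n a q i ∧ dot μ (i * n) a q n = 0 := by
  refine ⟨fun h => ⟨fun r hr => h r (by omega), h i (by omega)⟩, fun h r hr => ?_⟩
  rcases Nat.lt_succ_iff_lt_or_eq.1 hr with hr | rfl
  exacts [h.1 r hr, h.2]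

open Classical in
lemma runs_rowsProg {w B : ℕ} (hB : 2 * B < 2 ^ w) {s : State} {m n a q D : ℕ}
    (h0 : s.reg 0 = m) (h1 : s.reg 1 = n) (h3 : s.reg 3 = 0) (h4 : s.reg 4 = 1)
    (h12 : s.reg 12 = a) (h6 : s.reg 6 = q) (hD : ∀ l < m * n, |s.mem l| ≤ D)
    (ha : ∀ l < n, s.mem (a + l) = 0 ∨ s.mem (a + l) = 1)
    (hq : ∀ l < n, s.mem (q + l) = 0 ∨ s.mem (q + l) = 1)
    (hnD : n * D ≤ B) (hm : m ≤ B) (hmn : m * n ≤ B) (haB : a + n ≤ B) (hqB : q + n ≤ B)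
    (h1B : 1 ≤ B) :
    Runs w rowsProg s (m * (n * 12 + 10) + 4) fun s' =>
      s'.mem = s.mem ∧ s'.reg 16 = (if SameImage s.mem n a q m then 0 else 1) ∧
        ∀ r < 14, s'.reg r = s.reg r := by
  refine .const hB (by simp) (.const hB (by simp) (.const hB (by simp) ?_))
  refine (Runs.loop (N := m) (T := n * 12 + 9) (fun i s' => s'.reg 14 = i ∧ s'.mem = s.mem ∧
    s'.reg 15 = (i * n : ℕ) ∧ s'.reg 16 = (if SameImage s.mem n a q i then 0 else 1) ∧
    ∀ r < 14, s'.reg r = s.reg r) ?_ ?_ ?_).mono le_rfl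
    fun s' h => ⟨h.2.1, h.2.2.2⟩
  · refine ⟨by simp [State.set_reg], rfl, by simp [State.set_reg], ?_, fun r hr => ?_⟩
    · simp [SameImage]
    · simp only [State.set_reg]
      iterate 3 rw [if_neg (by omega)]
  · rintro i s' - ⟨h14, -, -, -, hf⟩
    simp [Cmp.Holds, h14, hf, h0]
  · rintro i s' hi ⟨h14, hmem, h15, h16, hf⟩
    have hin : (i + 1) * n ≤ m * n := Nat.mul_le_mul_right _ hi
    rw [add_mul, one_mul] at hin
    refine ((runs_dotProg hB (n := n) (R := i * n) (a := a) (q := q) (D := D) (by simp [hf, h1])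
      (by simp [hf, h4]) h15 (by simp [hf, h12]) (by simp [hf, h6])
      (fun l hl => by rw [hmem]; exact hD _ (by omega)) (by simpa [hmem] using ha)
      (by simpa [hmem] using hq) hnD (by omega) haB hqB h1B).seq (T' := 6)
      (R := fun s' => _) ?_).mono (by omega) fun s' h => h
    rintro s₁ ⟨hmem₁, h18, hf₁⟩
    rw [hmem] at hmem₁ h18
    refine (Runs.branch (T := 2) (Q := fun s₂ => s₂.mem = s.mem ∧
      s₂.reg 16 = (if SameImage s.mem n a q (i + 1) then 0 else 1) ∧
      ∀ r, r ≠ 16 → s₂.reg r = s₁.reg r) ?_ ?_).seq (T' := 3) ?_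
    · intro hc
      refine .const hB (by simpa using h1B) (.nop ⟨by simp [hmem₁], ?_, fun r hr => ?_⟩)
      · rw [if_neg]
        · simp
        · rw [sameImage_succ]
          simp only [Cmp.Holds, h18, hf₁ 3 (by omega), hf 3 (by omega), h3] at hc
          exact fun h => hc h.2
      · rw [State.set_reg_of_ne _ _ hr]
    · intro hc
      simp only [Cmp.Holds, h18, hf₁ 3 (by omega), hf 3 (by omega), h3, not_not] at hc
      refine Runs.mono (.nop (Q := fun s₂ => s₂.mem = s.mem ∧
        s₂.reg 16 = (if SameImage s.mem n a q (i + 1) then 0 else 1) ∧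
        ∀ r, r ≠ 16 → s₂.reg r = s₁.reg r) ⟨hmem₁, ?_, fun _ _ => rfl⟩) (by omega) fun _ h => h
      simp [sameImage_succ, hc, hf₁, h16]
    · rintro s₂ ⟨hmem₂, h16', hf₂⟩
      refine .add_nat hB (x := i * n) (y := n) (by simp [hf₂, hf₁, h15])
        (by simp [hf₂, hf₁, hf, h1]) (by omega) ?_
      refine .add_nat hB (x := i) (y := 1) (by simp [State.set_reg, hf₂, hf₁, h14])
        (by simp [State.set_reg, hf₂, hf₁, hf, h4]) (by omega) (.nop ?_)
      refine ⟨by simp, by simp [hmem₂], ?_, by simpa [State.set_reg] using h16', fun r hr => ?_⟩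
      · simp [State.set_reg]; ring
      · simp only [State.set_reg]
        iterate 2 rw [if_neg (by omega)]
        rw [hf₂ r (by omega), hf₁ r (by omega), hf r hr]

/-- One round of `scanProg`. -/
def scanBody : Prog :=
  .seq rowsProg <|
  .seq (.branch .eq 16 3 (.seq (.instr (.const 13 1)) .nop) .nop) <|
  .seq (.instr (.op .add 12 12 1)) <| .seq (.instr (.op .add 11 11 4)) .nop

/-- Decide whether the image of the vector at the address in register `6` occurs among the images
of the listed vectors. -/
def scanProg : Prog :=
  .seq (.instr (.const 11 0)) <| .seq (.instr (.copy 12 2)) <| .seq (.instr (.const 13 0)) <|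
  .loop .lt 11 5 scanBody

open Classical in
lemma runs_scanProg {w B : ℕ} (hB : 2 * B < 2 ^ w) {s : State} {m n p k q D : ℕ}
    (h0 : s.reg 0 = m) (h1 : s.reg 1 = n) (h2 : s.reg 2 = p) (h3 : s.reg 3 = 0)
    (h4 : s.reg 4 = 1) (h5 : s.reg 5 = k) (h6 : s.reg 6 = q)
    (hD : ∀ l < m * n, |s.mem l| ≤ D)
    (ha : ∀ t < k, ∀ l < n, s.mem (p + t * n + l) = 0 ∨ s.mem (p + t * n + l) = 1)
    (hq : ∀ l < n, s.mem (q + l) = 0 ∨ s.mem (q + l) = 1)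
    (hnD : n * D ≤ B) (hm : m ≤ B) (hmn : m * n ≤ B) (hk : k ≤ B) (hpB : p + k * n ≤ B)
    (hqB : q + n ≤ B) (h1B : 1 ≤ B) :
    Runs w scanProg s (k * (m * (n * 12 + 10) + 11) + 4) fun s' =>
      s'.mem = s.mem ∧
        s'.reg 13 = (if ∃ t < k, SameImage s.mem n (p + t * n) q m then 1 else 0) ∧
        ∀ r < 11, s'.reg r = s.reg r := by
  refine .const hB (by simp) (.copy hB (x := p) (by simp [State.set_reg, h2]) (by omega)
    (.const hB (by simp) ?_))
  refine (Runs.loop (N := k) (T := m * (n * 12 + 10) + 10) (fun t s' => s'.reg 11 = t ∧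
    s'.mem = s.mem ∧ s'.reg 12 = (p + t * n : ℕ) ∧
    s'.reg 13 = (if ∃ t' < t, SameImage s.mem n (p + t' * n) q m then 1 else 0) ∧
    ∀ r < 11, s'.reg r = s.reg r) ?_ ?_ ?_).mono le_rfl
    fun s' h => ⟨h.2.1, h.2.2.2⟩
  · refine ⟨by simp [State.set_reg], rfl, by simp [State.set_reg], by simp, fun r hr => ?_⟩
    simp only [State.set_reg]
    iterate 3 rw [if_neg (by omega)]
  · rintro i s' - ⟨h11, -, -, -, hf⟩
    simp [Cmp.Holds, h11, hf, h5]
  · rintro t s' ht ⟨h11, hmem, h12, h13, hf⟩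
    have htn : (t + 1) * n ≤ k * n := Nat.mul_le_mul_right _ ht
    rw [add_mul, one_mul] at htn
    refine ((runs_rowsProg hB (m := m) (n := n) (a := p + t * n) (q := q) (D := D)
      (by simp [hf, h0]) (by simp [hf, h1]) (by simp [hf, h3])
      (by simp [hf, h4]) h12 (by simp [hf, h6]) (by simpa [hmem] using hD)
      (by simpa [hmem] using ha t ht)
      (by simpa [hmem] using hq) hnD hm hmn (by omega) hqB h1B).seq (T' := 6)
      (R := fun s' => _) ?_).mono (by omega) fun s' h => h
    rintro s₁ ⟨hmem₁, h16, hf₁⟩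
    rw [hmem] at hmem₁ h16
    refine (Runs.branch (T := 2) (Q := fun s₂ => s₂.mem = s.mem ∧
      s₂.reg 13 = (if ∃ t' < t + 1, SameImage s.mem n (p + t' * n) q m then 1 else 0) ∧
      ∀ r, r ≠ 13 → s₂.reg r = s₁.reg r) ?_ ?_).seq (T' := 3) ?_
    · intro hc
      refine .const hB (by simpa using h1B) (.nop ⟨by simp [hmem₁], ?_, fun r hr => ?_⟩)
      · rw [if_pos]
        · simp
        · simp only [Cmp.Holds, h16, hf₁ 3 (by omega), hf 3 (by omega), h3] at hc
          exact ⟨t, by omega, by simpa using hc⟩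
      · rw [State.set_reg_of_ne _ _ hr]
    · intro hc
      have hc' : ¬ SameImage s.mem n (p + t * n) q m := by
        simpa [Cmp.Holds, h16, hf₁ 3 (by omega), hf 3 (by omega), h3] using hc
      refine Runs.mono (.nop (Q := fun s₂ => s₂.mem = s.mem ∧
        s₂.reg 13 = (if ∃ t' < t + 1, SameImage s.mem n (p + t' * n) q m then 1 else 0) ∧
        ∀ r, r ≠ 13 → s₂.reg r = s₁.reg r) ⟨hmem₁, ?_, fun _ _ => rfl⟩) (by omega) fun _ h => h
      have : (∃ t' < t + 1, SameImage s.mem n (p + t' * n) q m) ↔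
          ∃ t' < t, SameImage s.mem n (p + t' * n) q m := by
        refine ⟨?_, fun ⟨t', h, h'⟩ => ⟨t', by omega, h'⟩⟩
        rintro ⟨t', h, h'⟩
        rcases Nat.lt_succ_iff_lt_or_eq.1 h with h | rfl
        exacts [⟨t', h, h'⟩, absurd h' hc']
      simp only [this, hf₁ 13 (by omega), h13]
    · rintro s₂ ⟨hmem₂, h13', hf₂⟩
      refine .add_nat hB (x := p + t * n) (y := n) (by simp [hf₂, hf₁, h12])
        (by simp [hf₂, hf₁, hf, h1]) (by omega) ?_
      refine .add_nat hB (x := t) (y := 1) (by simp [State.set_reg, hf₂, hf₁, h11])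
        (by simp [State.set_reg, hf₂, hf₁, hf, h4]) (by omega) (.nop ?_)
      refine ⟨by simp, by simp [hmem₂], ?_, by simpa [State.set_reg] using h13', fun r hr => ?_⟩
      · simp [State.set_reg]; ring
      · simp only [State.set_reg]
        iterate 2 rw [if_neg (by omega)]
        rw [hf₂ r (by omega), hf₁ r (by omega), hf r hr]

/-! ### Writing a candidate -/

/-- One round of `copyProg`. -/
def copyBody : Prog :=
  .seq (.instr (.op .add 19 10 17)) <| .seq (.instr (.load 19 19)) <|
  .seq (.instr (.op .add 20 6 17)) <| .seq (.instr (.store 20 19)) <|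
  .seq (.instr (.op .add 17 17 4)) .nop

/-- Copy the vector at the address in register `10` to the address in register `6`, and set the
coordinate in register `7` to `1`. -/
def copyProg : Prog :=
  .seq (.instr (.const 17 0)) <| .seq (.loop .lt 17 1 copyBody) <|
  .seq (.instr (.op .add 19 6 7)) <| .seq (.instr (.store 19 4)) .nop

/-- The hypothesis `b + n ≤ q` places the target behind the source, so the source is not overwritten
while it is read. -/
lemma runs_copyProg {w B : ℕ} (hB : 2 * B < 2 ^ w) {s : State} {n j b q : ℕ}
    (h1 : s.reg 1 = n) (h4 : s.reg 4 = 1) (h6 : s.reg 6 = q) (h7 : s.reg 7 = j)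
    (h10 : s.reg 10 = b) (hj : j < n) (hbq : b + n ≤ q)
    (hb : ∀ l < n, s.mem (b + l) = 0 ∨ s.mem (b + l) = 1)
    (hqB : q + n ≤ B) (h1B : 1 ≤ B) :
    Runs w copyProg s (n * 7 + 5) fun s' =>
      (∀ x < q, s'.mem x = s.mem x) ∧
        (∀ l < n, s'.mem (q + l) = if l = j then 1 else s.mem (b + l)) ∧
        ∀ r < 17, s'.reg r = s.reg r := by
  refine Runs.mono (.const hB (by simp) (T := n * 7 + 1 + 3) ?_) le_rfl fun _ h => h
  refine (Runs.loop (N := n) (T := 6) (fun i s' => s'.reg 17 = i ∧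
    (∀ x < q, s'.mem x = s.mem x) ∧ (∀ l < i, s'.mem (q + l) = s.mem (b + l)) ∧
    ∀ r < 17, s'.reg r = s.reg r) ?_ ?_ ?_).seq ?_
  · refine ⟨by simp, fun x _ => rfl, by simp, fun r hr => ?_⟩
    rw [State.set_reg_of_ne _ _ hr.ne]
  · rintro i s' - ⟨h17, -, -, hf⟩
    simp [Cmp.Holds, h17, hf, h1]
  · rintro i s' hi ⟨h17, hlow, hcopied, hf⟩
    have habs : |s.mem (b + i)| ≤ (B : ℤ) := by
      rcases hb i hi with h | h <;> simp [h, h1B]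
    refine .add_nat hB (x := b) (y := i) (by simp [hf, h10]) h17 (by omega) ?_
    refine .load hB (x := b + i) (by simp) (by simpa [hlow _ (show b + i < q by omega)]) ?_
    refine .add_nat hB (x := q) (y := i) (by simp [State.set_reg, hf, h6])
      (by simp [State.set_reg, h17]) (by omega) ?_
    refine .store hB (x := q + i) (v := s.mem (b + i)) (by simp)
      (by simp [State.set_reg, hlow _ (show b + i < q by omega)]) habs ?_
    refine .add_nat hB (x := i) (y := 1) (by simp [State.set_reg, h17])
      (by simp [State.set_reg, hf, h4]) (by omega) (.nop ?_)
    refine ⟨by simp, fun x hx => ?_, fun l hl => ?_, fun r hr => ?_⟩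
    · simp [State.write_mem, hlow x hx, show x ≠ q + i by omega]
    · simp only [State.set_mem, State.write_mem]
      rcases Nat.lt_succ_iff_lt_or_eq.1 hl with hl | rfl
      · rw [if_neg (by omega), hcopied l hl]
      · rw [if_pos rfl]
    · simp only [State.set_reg, State.write_reg]
      iterate 4 rw [if_neg (by omega)]
      exact hf r hr
  · rintro s' ⟨-, hlow, hcopied, hf⟩
    refine .add_nat hB (x := q) (y := j) (by simp [hf, h6]) (by simp [hf, h7]) (by omega) ?_
    refine .store hB (x := q + j) (v := 1) (by simp) (by simp [State.set_reg, hf, h4])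
      (by simpa using h1B) (.nop ⟨fun x hx => ?_, fun l hl => ?_, fun r hr => ?_⟩)
    · simp [State.write_mem, hlow x hx, show x ≠ q + j by omega]
    · simp [State.write_mem, hcopied l hl]
    · rw [State.write_reg, State.set_reg, if_neg (by omega), hf r hr]

end WordRAM

namespace WordRAM

open Function SmallSupport

variable {m n : ℕ}

/-! ### The machine computes the candidate list -/

/-- The machine stores the matrix `A` and, behind it, the vectors of the list `L`. -/
structure Stores (A : Matrix (Fin m) (Fin n) ℤ) (L : List (Fin n → ℤ)) (s : State) : Prop where
  reg0 : s.reg 0 = m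
  reg1 : s.reg 1 = n
  reg2 : s.reg 2 = (m * n : ℕ)
  reg3 : s.reg 3 = 0
  reg4 : s.reg 4 = 1
  reg5 : s.reg 5 = L.length
  reg6 : s.reg 6 = (m * n + L.length * n : ℕ)
  matrix : ∀ (i : Fin m) (l : Fin n), s.mem (i * n + l) = A i l
  list : ∀ t (ht : t < L.length) (l : Fin n), s.mem (m * n + t * n + l) = L[t] l

/-- Words of length `w` hold all numbers up to `B`, and `B` is large enough for the computation
with `A`. -/
structure Fits (A : Matrix (Fin m) (Fin n) ℤ) (w B M : ℕ) : Prop where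
  word : 2 * B < 2 ^ w
  one_le : 1 ≤ B
  rows : m ≤ B
  cols : n ≤ B
  length : M ≤ B
  sums : n * maxAbsEntry A ≤ B
  memory : m * n + (M + 1) * n ≤ B
  card : (2 * (n * maxAbsEntry A) + 1) ^ m ≤ M

lemma abs_mem_le {A : Matrix (Fin m) (Fin n) ℤ} {μ : ℕ → ℤ}
    (hA : ∀ (i : Fin m) (l : Fin n), μ (i * n + l) = A i l) {x : ℕ} (hx : x < m * n) :
    |μ x| ≤ maxAbsEntry A := by
  have hn : 0 < n := Nat.pos_of_mul_pos_left (by omega : 0 < m * n)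
  have h := hA ⟨x / n, Nat.div_lt_of_lt_mul (by rwa [mul_comm])⟩ ⟨x % n, Nat.mod_lt _ hn⟩
  simp only [Nat.div_add_mod'] at h
  rw [h]
  exact abs_le_maxAbsEntry A _ _

lemma sameImage_iff {A : Matrix (Fin m) (Fin n) ℤ} {μ : ℕ → ℤ}
    (hA : ∀ (i : Fin m) (l : Fin n), μ (i * n + l) = A i l) {a q : ℕ} {x y : Fin n → ℤ}
    (hx : ∀ l : Fin n, μ (a + l) = x l) (hy : ∀ l : Fin n, μ (q + l) = y l) :
    SameImage μ n a q m ↔ A.mulVec x = A.mulVec y := by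
  have h : ∀ i : Fin m, dot μ (i * n) a q n = A.mulVec x i - A.mulVec y i := by
    intro i
    rw [← Pi.sub_apply, ← Matrix.mulVec_sub, dot, Finset.sum_range]
    exact Finset.sum_congr rfl fun l _ => by rw [hA, hx, hy, Pi.sub_apply]
  rw [funext_iff]
  refine ⟨fun H i => sub_eq_zero.1 ((h i).symm.trans (H i i.2)), fun H i hi => ?_⟩
  exact (h ⟨i, hi⟩).trans (sub_eq_zero.2 (H ⟨i, hi⟩))

/-- One round of the loop over the listed vectors. -/
def extendBody : Prog :=
  .seq copyProg <| .seq scanProg <|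
  .seq (.branch .ne 13 4 (.seq (.instr (.op .add 5 5 4)) <| .seq (.instr (.op .add 6 6 1)) .nop)
    .nop) <|
  .seq (.instr (.op .add 9 9 4)) <| .seq (.instr (.op .add 10 10 1)) .nop

/-- A bound for the running time of `extendBody`. -/
def extendTime (m n M : ℕ) : ℕ := n * 7 + M * (m * (n * 12 + 10) + 11) + 16

lemma runs_extendBody {A : Matrix (Fin m) (Fin n) ℤ} {w B M : ℕ} (hF : Fits A w B M)
    {L : List (Fin n → ℤ)} {s : State} (hs : Stores A L s) (hd : DistinctImages A L)
    (h01 : ZeroOne L) (j : Fin n) (h7 : s.reg 7 = (j : ℕ)) {i : ℕ} (hi : i < L.length)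
    (h9 : s.reg 9 = i) (h10 : s.reg 10 = (m * n + i * n : ℕ)) :
    Runs w extendBody s (extendTime m n M) fun s' =>
      Stores A (extend A j L L[i]) s' ∧ s'.reg 7 = (j : ℕ) ∧ s'.reg 8 = s.reg 8 ∧
        s'.reg 9 = (i + 1 : ℕ) ∧ s'.reg 10 = (m * n + (i + 1) * n : ℕ) := by
  have hB := hF.word
  have h1B := hF.one_le
  have hlen : L.length ≤ M := (hd.length_le h01).trans hF.card
  have hin : (i + 1) * n ≤ L.length * n := Nat.mul_le_mul_right _ hi
  have hLn : L.length * n ≤ M * n := Nat.mul_le_mul_right _ hlen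
  have hmem := hF.memory
  have hMB := hF.length
  rw [add_mul, one_mul] at hin hmem
  have h01' : ∀ t (ht : t < L.length) (l : Fin n),
      s.mem (m * n + t * n + l) = 0 ∨ s.mem (m * n + t * n + l) = 1 := fun t ht l => by
    rw [hs.list t ht l]
    exact h01 _ (List.getElem_mem _) l
  -- The candidate is written directly behind the list before it is tested; the extra vector in
  -- `Fits.memory` is this scratch space. Accepting it only advances registers `5` and `6`;
  -- rejecting it leaves it to be overwritten.
  refine ((runs_copyProg hB hs.reg1 hs.reg4 hs.reg6 h7 h10 j.2 (by omega)
    (fun l hl => h01' i hi ⟨l, hl⟩) (by omega) h1B).seq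
    (T' := M * (m * (n * 12 + 10) + 11) + 11) (R := fun s' => _) ?_).mono
    (by unfold extendTime; omega) fun s' h => h
  rintro s₁ ⟨hlow, hnew, hf₁⟩
  set x := update L[i] j 1 with hxdef
  have hmat : ∀ (i : Fin m) (l : Fin n), s₁.mem (i * n + l) = A i l := fun i l => by
    have : (i + 1) * n ≤ m * n := Nat.mul_le_mul_right _ i.2
    rw [add_mul, one_mul] at this
    rw [hlow _ (by omega), hs.matrix]
  have hlist : ∀ t (ht : t < L.length) (l : Fin n), s₁.mem (m * n + t * n + l) = L[t] l := by
    intro t ht l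
    have : (t + 1) * n ≤ L.length * n := Nat.mul_le_mul_right _ ht
    rw [add_mul, one_mul] at this
    rw [hlow _ (by omega), hs.list t ht]
  have hx : ∀ l : Fin n, s₁.mem (m * n + L.length * n + l) = x l := by
    intro l
    rw [hnew l l.2, hs.list i hi l, hxdef, update_apply]
    simp only [Fin.ext_iff]
  have hx01 : ∀ l, x l = 0 ∨ x l = 1 := by
    intro l
    rw [hxdef, update_apply]
    split_ifs
    · exact Or.inr rfl
    · exact h01 _ (List.getElem_mem _) l
  have hreg : ∀ r < 11, ∀ v, s.reg r = v → s₁.reg r = v := fun r hr v hv => by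
    rw [hf₁ r (by omega), hv]
  refine ((runs_scanProg hB (hreg 0 (by omega) _ hs.reg0) (hreg 1 (by omega) _ hs.reg1)
    (hreg 2 (by omega) _ hs.reg2) (hreg 3 (by omega) _ hs.reg3) (hreg 4 (by omega) _ hs.reg4)
    (hreg 5 (by omega) _ hs.reg5) (hreg 6 (by omega) _ hs.reg6)
    (fun l hl => abs_mem_le hmat hl)
    (fun t ht l hl => by
      rw [hlist t ht ⟨l, hl⟩]
      exact h01 _ (List.getElem_mem _) _)
    (fun l hl => by
      rw [hx ⟨l, hl⟩]
      exact hx01 _)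
    hF.sums hF.rows (by omega) (by omega) (by omega) (by omega) h1B).seq
    (T' := 7) (R := fun s' => _) ?_).mono
    (by
      have := Nat.mul_le_mul_right (m * (n * 12 + 10) + 11) hlen
      omega) fun s' h => h
  rintro s₂ ⟨hmem₂, h13, hf₂⟩
  have hiff : (∃ t < L.length, SameImage s₁.mem n (m * n + t * n) (m * n + L.length * n) m) ↔
      ∃ y ∈ L, A.mulVec y = A.mulVec x := by
    simp only [List.mem_iff_getElem]
    constructor
    · rintro ⟨t, ht, h⟩
      exact ⟨_, ⟨t, ht, rfl⟩, (sameImage_iff hmat (hlist t ht) hx).1 h⟩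
    · rintro ⟨_, ⟨t, ht, rfl⟩, h⟩
      exact ⟨t, ht, (sameImage_iff hmat (hlist t ht) hx).2 h⟩
  simp only [hiff] at h13
  have hreg₂ : ∀ r < 11, ∀ v, s.reg r = v → s₂.reg r = v := fun r hr v hv => by
    rw [hf₂ r (by omega), hreg r hr v hv]
  refine (Runs.branch (T := 3) (Q := fun s₃ => Stores A (extend A j L L[i]) s₃ ∧
    ∀ r, r ≠ 5 → r ≠ 6 → s₃.reg r = s₂.reg r) ?_ ?_).seq (T' := 3) ?_
  · intro hc
    have hc' : ¬ ∃ y ∈ L, A.mulVec y = A.mulVec x := by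
      simpa [Cmp.Holds, h13, hreg₂ 4 (by omega) _ hs.reg4] using hc
    have hext : extend A j L L[i] = L ++ [x] := if_neg hc'
    -- The longer list still has distinct images, so the counting bound applies to it and the
    -- counter does not overflow.
    have hlen' : L.length + 1 ≤ M := by
      have hd' := hd.extend j L[i]
      have h01'' : ZeroOne (L ++ [x]) := by
        intro y hy
        rcases List.mem_append.1 hy with hy | hy
        · exact h01 y hy
        · rw [List.mem_singleton.1 hy]; exact hx01
      rw [hext] at hd'
      simpa using (hd'.length_le h01'').trans hF.card
    refine .add_nat hB (x := L.length) (y := 1) (hreg₂ 5 (by omega) _ hs.reg5)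
      (by simp [hreg₂ 4 (by omega) _ hs.reg4]) (by omega) ?_
    refine .add_nat hB (x := m * n + L.length * n) (y := n)
      (by simpa [State.set_reg] using hreg₂ 6 (by omega) _ hs.reg6)
      (by simp [State.set_reg, hreg₂ 1 (by omega) _ hs.reg1]) (by omega) (.nop ⟨?_, ?_⟩)
    · rw [hext]
      refine ⟨by simpa [State.set_reg] using hreg₂ 0 (by omega) _ hs.reg0,
        by simpa [State.set_reg] using hreg₂ 1 (by omega) _ hs.reg1,
        by simpa [State.set_reg] using hreg₂ 2 (by omega) _ hs.reg2,
        by simpa [State.set_reg] using hreg₂ 3 (by omega) _ hs.reg3,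
        by simpa [State.set_reg] using hreg₂ 4 (by omega) _ hs.reg4,
        by simp [State.set_reg], by simp; ring,
        by simpa [hmem₂] using hmat, ?_⟩
      intro t ht l
      simp only [State.set_mem, hmem₂]
      rw [List.length_append, List.length_singleton] at ht
      rcases Nat.lt_succ_iff_lt_or_eq.1 ht with ht | rfl
      · rw [List.getElem_append_left ht, hlist t ht l]
      · simp [hx]
    · intro r hr hr'
      simp [State.set_reg, hr, hr']
  · intro hc
    have hc' : ∃ y ∈ L, A.mulVec y = A.mulVec x := by
      by_contra h
      exact hc (by simp [Cmp.Holds, h13, h, hreg₂ 4 (by omega) _ hs.reg4])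
    have hext : extend A j L L[i] = L := if_pos hc'
    refine Runs.mono (.nop (Q := fun s₃ => Stores A (extend A j L L[i]) s₃ ∧
      ∀ r, r ≠ 5 → r ≠ 6 → s₃.reg r = s₂.reg r) ⟨?_, fun _ _ _ => rfl⟩) (by omega) fun _ h => h
    rw [hext]
    exact ⟨hreg₂ 0 (by omega) _ hs.reg0, hreg₂ 1 (by omega) _ hs.reg1,
      hreg₂ 2 (by omega) _ hs.reg2, hreg₂ 3 (by omega) _ hs.reg3, hreg₂ 4 (by omega) _ hs.reg4,
      hreg₂ 5 (by omega) _ hs.reg5, hreg₂ 6 (by omega) _ hs.reg6,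
      by simpa [hmem₂] using hmat, by simpa [hmem₂] using hlist⟩
  · rintro s₃ ⟨hs₃, hf₃⟩
    have hreg₃ : ∀ r < 11, r ≠ 5 → r ≠ 6 → ∀ v, s.reg r = v → s₃.reg r = v :=
      fun r hr h5 h6 v hv => by rw [hf₃ r h5 h6, hreg₂ r hr v hv]
    refine .add_nat hB (x := i) (y := 1) (hreg₃ 9 (by omega) (by omega) (by omega) _ h9)
      (by simp [hs₃.reg4]) (by omega) ?_
    refine .add_nat hB (x := m * n + i * n) (y := n)
      (by simpa [State.set_reg] using hreg₃ 10 (by omega) (by omega) (by omega) _ h10)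
      (by simp [State.set_reg, hs₃.reg1]) (by omega) (.nop ⟨?_, ?_, ?_, ?_, ?_⟩)
    · exact ⟨by simpa [State.set_reg] using hs₃.reg0, by simpa [State.set_reg] using hs₃.reg1,
        by simpa [State.set_reg] using hs₃.reg2, by simpa [State.set_reg] using hs₃.reg3,
        by simpa [State.set_reg] using hs₃.reg4, by simpa [State.set_reg] using hs₃.reg5,
        by simpa [State.set_reg] using hs₃.reg6, hs₃.matrix, hs₃.list⟩
    · simpa [State.set_reg] using hreg₃ 7 (by omega) (by omega) (by omega) _ h7
    · simpa [State.set_reg] using hreg₃ 8 (by omega) (by omega) (by omega) _ rfl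
    · simp [State.set_reg]
    · simp; ring

/-- One round of the loop over the columns. -/
def stageBody : Prog :=
  .seq (.instr (.copy 8 5)) <| .seq (.instr (.const 9 0)) <| .seq (.instr (.copy 10 2)) <|
  .seq (.loop .lt 9 8 extendBody) <| .seq (.instr (.op .add 7 7 4)) .nop

/-- A bound for the running time of `stageBody`. -/
def stageTime (m n M : ℕ) : ℕ := M * (extendTime m n M + 1) + 6

lemma Stores.of_reg_eq {A : Matrix (Fin m) (Fin n) ℤ} {L : List (Fin n → ℤ)} {s s' : State}
    (h : Stores A L s) (hreg : ∀ r < 7, s'.reg r = s.reg r) (hmem : s'.mem = s.mem) :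
    Stores A L s' :=
  ⟨(hreg 0 (by omega)).trans h.reg0, (hreg 1 (by omega)).trans h.reg1,
    (hreg 2 (by omega)).trans h.reg2, (hreg 3 (by omega)).trans h.reg3,
    (hreg 4 (by omega)).trans h.reg4, (hreg 5 (by omega)).trans h.reg5,
    (hreg 6 (by omega)).trans h.reg6, by rw [hmem]; exact h.matrix, by rw [hmem]; exact h.list⟩

lemma runs_stageBody {A : Matrix (Fin m) (Fin n) ℤ} {w B M : ℕ} (hF : Fits A w B M)
    {s : State} {j : ℕ} (hj : j < n) (hs : Stores A (stage A j) s) (h7 : s.reg 7 = j) :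
    Runs w stageBody s (stageTime m n M) fun s' =>
      Stores A (stage A (j + 1)) s' ∧ s'.reg 7 = (j + 1 : ℕ) := by
  have hB := hF.word
  have h1B := hF.one_le
  set L := stage A j with hL
  have hd : DistinctImages A L := distinctImages_stage A j
  have h01 : ZeroOne L := zeroOne_stage A j
  have hlen : L.length ≤ M := (hd.length_le h01).trans hF.card
  have hMB := hF.length
  have hmem := hF.memory
  have hnB := hF.cols
  refine Runs.mono (T := (L.length * (extendTime m n M + 1) + 1 + 2) + 1 + 1 + 1) ?_ ?_
    fun s' h => h
  swap
  · have := Nat.mul_le_mul_right (extendTime m n M + 1) hlen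
    unfold stageTime
    omega
  refine .copy hB (x := L.length) hs.reg5 (by omega) (.const hB (by simp)
    (.copy hB (x := m * n) (by simp [State.set_reg, hs.reg2]) (by omega) ?_))
  refine ((Runs.loop (N := L.length) (T := extendTime m n M) (fun i s' =>
    Stores A ((L.take i).foldl (extend A ⟨j, hj⟩) L) s' ∧ s'.reg 7 = j ∧
    s'.reg 8 = L.length ∧ s'.reg 9 = i ∧ s'.reg 10 = (m * n + i * n : ℕ)) ?_ ?_ ?_).seq (T' := 2)
    (R := fun s' => _) ?_).mono le_rfl fun s' h => h
  · refine ⟨?_, by simp [State.set_reg, h7], by simp [State.set_reg], by simp [State.set_reg],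
      by simp⟩
    refine hs.of_reg_eq (fun r hr => ?_) rfl
    simp only [State.set_reg]
    iterate 3 rw [if_neg (by omega)]
  · rintro i s' - ⟨-, -, h8, h9, -⟩
    simp [Cmp.Holds, h8, h9]
  · rintro i s' hi ⟨hs', h7', h8', h9', h10'⟩
    -- The list grows while it is traversed, but only at its end: entry `i` is still that of the old
    -- list, whose length is frozen in register `8`.
    obtain ⟨L', hL'⟩ := prefix_foldl_extend A ⟨j, hj⟩ (L.take i) L
    have hi' : i < ((L.take i).foldl (extend A ⟨j, hj⟩) L).length := by
      rw [← hL', List.length_append]; omega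
    have hget : ((L.take i).foldl (extend A ⟨j, hj⟩) L)[i] = L[i] := by
      simp only [← hL', List.getElem_append_left hi]
    refine (runs_extendBody hF hs' (hd.foldl_extend _ _)
      (h01.foldl_extend (fun x hx => h01 x (List.mem_of_mem_take hx)) _) ⟨j, hj⟩ h7' hi' h9'
      h10').mono le_rfl ?_
    rintro s'' ⟨h1, h2, h3, h4, h5⟩
    rw [hget] at h1
    refine ⟨?_, h2, h3.trans h8', h4, h5⟩
    rwa [List.take_succ_eq_append_getElem hi, List.foldl_append]
  · rintro s' ⟨hs', h7', -⟩
    rw [List.take_length] at hs'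
    refine .add_nat hB (x := j) (y := 1) h7' (by simp [hs'.reg4]) (by omega) (.nop ⟨?_, by simp⟩)
    have hst : stage A (j + 1) = L.foldl (extend A ⟨j, hj⟩) L := by rw [stage, dif_pos hj]
    rw [hst]
    exact hs'.of_reg_eq (fun r hr => by rw [State.set_reg, if_neg (by omega)]) rfl

/-- The program that lists the candidate supports. -/
def supportProg : Prog :=
  .seq (.instr (.const 4 1)) <| .seq (.instr (.op .mul 2 0 1)) <| .seq (.instr (.const 5 1)) <|
  .seq (.instr (.op .add 6 2 1)) <| .seq (.loop .lt 7 1 stageBody) <|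
  .seq (.instr (.copy 0 5)) <| .seq (.instr (.copy 1 2)) .nop

lemma runs_supportProg {A : Matrix (Fin m) (Fin n) ℤ} {w B M : ℕ} (hF : Fits A w B M) :
    Runs w supportProg (input A) (n * (stageTime m n M + 1) + 8) fun s' =>
      Outputs s' {x | x ∈ stage A n} := by
  have hB := hF.word
  have h1B := hF.one_le
  have hmem := hF.memory
  have hnB := hF.cols
  rw [add_mul, one_mul] at hmem
  refine Runs.mono (T := n * (stageTime m n M + 1) + 1 + 3 + 1 + 1 + 1 + 1) ?_ (by omega)
    fun s' h => h
  refine .const hB (by simpa using h1B) ?_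
  refine .mul hB (x := m) (y := n) (by simp [State.set_reg, input])
    (by simp [State.set_reg, input]) ?_ ?_
  · rw [← Nat.cast_mul, Nat.abs_cast]
    exact_mod_cast (by omega : m * n ≤ B)
  refine .const hB (by simpa using h1B) (.add_nat hB (x := m * n) (y := n)
    (by simp [State.set_reg]) (by simp [State.set_reg, input]) (by omega) ?_)
  refine ((Runs.loop (N := n) (T := stageTime m n M)
    (fun j s' => Stores A (stage A j) s' ∧ s'.reg 7 = j) ⟨?_, ?_⟩ ?_ ?_).seq (T' := 3)
    (R := fun s' => _) ?_).mono le_rfl fun s' h => h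
  · refine ⟨by simp [State.set_reg, input], by simp [State.set_reg, input],
      by simp [State.set_reg], by simp [State.set_reg, input], by simp [State.set_reg],
      by simp [State.set_reg, stage], by simp [stage], ?_, ?_⟩
    · intro i l
      have h : (i : ℕ) * n + l = finProdFinEquiv (i, l) := by
        rw [finProdFinEquiv_apply_val, mul_comm, add_comm]
      simp only [State.set_mem, input, h, (finProdFinEquiv (i, l)).2, dif_pos, Fin.eta,
        Equiv.symm_apply_apply]
    · intro t ht l
      -- The initial list consists of the zero vector, already present because memory behind the
      -- matrix is zero.
      obtain rfl : t = 0 := by simpa [stage] using ht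
      change _ = (0 : Fin n → ℤ) l
      simp [input]
  · simp [State.set_reg, input]
  · rintro j s' - ⟨hs', h7⟩
    simp [Cmp.Holds, h7, hs'.reg1]
  · rintro j s' hj ⟨hs', h7⟩
    exact runs_stageBody hF hj hs' h7
  · rintro s' ⟨hs', -⟩
    have hlen := ((distinctImages_stage A n).length_le (zeroOne_stage A n)).trans
      (hF.card.trans hF.length)
    refine .copy hB hs'.reg5 hlen (.copy hB (x := m * n) (by simp [State.set_reg, hs'.reg2])
      (by omega) (.nop ⟨(stage A n).length, m * n, by simp [State.set_reg], by simp, ?_⟩))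
    ext x
    simp only [Set.mem_ofPred_eq, List.mem_iff_getElem, State.set_mem]
    constructor
    · rintro ⟨t, ht, rfl⟩
      exact ⟨t, ht, fun l => (hs'.list t ht l).symm⟩
    · rintro ⟨t, ht, h⟩
      exact ⟨t, ht, funext fun l => (hs'.list t ht l).symm.trans (h l).symm⟩

end WordRAM

open SmallSupport WordRAM

/-! ### Time and word-length estimates -/

/-- The resources that the listing of the candidate supports takes. -/
def resourceBound (m n Δ : ℕ) : ℕ :=
  2 ^ 8 * (n + 1) ^ 2 * (m + 1) * ((2 * (n * Δ) + 1) ^ m) ^ 2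

/-- With `N = nΔ ≥ 2` and `m ≥ 1` the four factors are at most `N^(8m)`, `N^(4m)`, `N^m` and
`N^(6m)`, whence `19 = 8 + 4 + 1 + 6`. In the degenerate cases `(2nΔ + 1)^m` is `1` or at most
`3^m`, and powers of `n + 2` suffice. -/
lemma resourceBound_le_powBound (m n Δ : ℕ) : resourceBound m n Δ ≤ powBound 19 m n Δ := by
  unfold resourceBound powBound
  have hm : m + 1 ≤ 2 ^ m := Nat.lt_two_pow_self
  split_ifs with h
  · obtain ⟨h1, h2⟩ := h
    have hn : n ≤ n * Δ := Nat.le_mul_of_pos_right n (Nat.pos_of_mul_pos_left (by omega : 0 < n * Δ))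
    generalize n * Δ = N at *
    have e1 : 2 ^ 8 ≤ N ^ (8 * m) := calc
      2 ^ 8 ≤ N ^ 8 := Nat.pow_le_pow_left h2 8
      _ ≤ N ^ (8 * m) := Nat.pow_le_pow_right (by omega) (by omega)
    have e2 : (n + 1) ^ 2 ≤ N ^ (4 * m) := calc
      (n + 1) ^ 2 ≤ (N ^ 2) ^ 2 := Nat.pow_le_pow_left (by nlinarith) 2
      _ = N ^ 4 := by ring
      _ ≤ N ^ (4 * m) := Nat.pow_le_pow_right (by omega) (by omega)
    have e3 : m + 1 ≤ N ^ m := hm.trans (Nat.pow_le_pow_left h2 m)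
    have e4 : ((2 * N + 1) ^ m) ^ 2 ≤ N ^ (6 * m) := calc
      ((2 * N + 1) ^ m) ^ 2 ≤ ((N ^ 3) ^ m) ^ 2 := by
        gcongr
        have : 2 * 2 * N ≤ N * N * N := by gcongr
        rw [pow_three']
        omega
      _ = N ^ (6 * m) := by rw [← pow_mul, ← pow_mul]; ring
    calc _ ≤ N ^ (8 * m) * N ^ (4 * m) * N ^ m * N ^ (6 * m) := by gcongr
      _ = N ^ (19 * m) := by rw [← pow_add, ← pow_add, ← pow_add]; ring
  · have h2 : 2 ≤ n + 2 := by omega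
    have hM : (2 * (n * Δ) + 1) ^ m ≤ (n + 2) ^ (2 * m) := by
      rcases Nat.eq_zero_or_pos m with rfl | hm0
      · simp
      · rw [pow_mul]
        have : 2 ^ 2 ≤ (n + 2) ^ 2 := Nat.pow_le_pow_left h2 2
        exact Nat.pow_le_pow_left (by omega) m
    calc _ ≤ (n + 2) ^ 8 * (n + 2) ^ 2 * (n + 2) ^ m * ((n + 2) ^ (2 * m)) ^ 2 := by
          have := hm.trans (Nat.pow_le_pow_left h2 m)
          gcongr
          omega
      _ = (n + 2) ^ (10 + 5 * m) := by rw [← pow_mul, ← pow_add, ← pow_add, ← pow_add]; ring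
      _ ≤ (n + 2) ^ (19 * (m + 1)) := Nat.pow_le_pow_right (by omega) (by omega)

lemma supportTime_le {m n M : ℕ} (hM : 1 ≤ M) :
    n * (stageTime m n M + 1) + 8 ≤ 2 ^ 8 * (n + 1) ^ 2 * (m + 1) * M ^ 2 := by
  have hu : 1 ≤ n + 1 := by omega
  have hv : 1 ≤ m + 1 := by omega
  unfold stageTime extendTime
  have e1 : m * (n * 12 + 10) + 11 ≤ 12 * ((n + 1) * (m + 1)) := by nlinarith
  generalize m * (n * 12 + 10) + 11 = a at *
  have e2 : n + 1 ≤ (n + 1) * (m + 1) * M := by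
    calc n + 1 = (n + 1) * 1 * 1 := by ring
      _ ≤ _ := by gcongr
  have e3 : n * 7 + M * a + 16 + 1 ≤ 29 * ((n + 1) * (m + 1) * M) := by
    have : M * a ≤ M * (12 * ((n + 1) * (m + 1))) := by gcongr
    linarith
  generalize n * 7 + M * a + 16 + 1 = c at *
  have e4 : 1 ≤ (n + 1) * (m + 1) * M * M := by
    calc 1 = 1 * 1 * 1 * 1 := rfl
      _ ≤ _ := by gcongr
  have e5 : M * c + 6 + 1 ≤ 36 * ((n + 1) * (m + 1) * M * M) := by
    have : M * c ≤ M * (29 * ((n + 1) * (m + 1) * M)) := by gcongr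
    linarith
  generalize M * c + 6 + 1 = d at *
  calc n * d + 8 ≤ (n + 1) * (36 * ((n + 1) * (m + 1) * M * M)) +
        (n + 1) * (8 * ((n + 1) * (m + 1) * M * M)) := by
        have h1 : n * d ≤ (n + 1) * (36 * ((n + 1) * (m + 1) * M * M)) := by gcongr; omega
        have h2 : 1 * (8 * 1) ≤ (n + 1) * (8 * ((n + 1) * (m + 1) * M * M)) := by gcongr
        linarith
    _ = 44 * (n + 1) ^ 2 * (m + 1) * M ^ 2 := by ring
    _ ≤ _ := by gcongr; norm_num

/-- The magnitude bound has `2^6` in place of `2^8`, so that its double is strictly below `2^w`. -/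
lemma fits_of_resourceBound_le {m n w : ℕ} (A : Matrix (Fin m) (Fin n) ℤ)
    (h : resourceBound m n (maxAbsEntry A) ≤ 2 ^ w) :
    Fits A w (2 ^ 6 * (n + 1) ^ 2 * (m + 1) * ((2 * (n * maxAbsEntry A) + 1) ^ m) ^ 2)
      ((2 * (n * maxAbsEntry A) + 1) ^ m) := by
  -- For `m = 0` the power is only `1`, but a matrix without rows has `Δ = 0`.
  have hS : n * maxAbsEntry A ≤ (2 * (n * maxAbsEntry A) + 1) ^ m := by
    rcases Nat.eq_zero_or_pos m with rfl | hm
    · simp [maxAbsEntry]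
    · exact (by omega : _ ≤ 2 * (n * maxAbsEntry A) + 1).trans (Nat.le_self_pow hm.ne' _)
  have hM : 1 ≤ (2 * (n * maxAbsEntry A) + 1) ^ m := Nat.one_le_pow _ _ (by omega)
  unfold resourceBound at h
  generalize hMA : (2 * (n * maxAbsEntry A) + 1) ^ m = M at *
  set W := (n + 1) ^ 2 * (m + 1) * M ^ 2 with hW
  have hu : 1 ≤ n + 1 := by omega
  have hv : 1 ≤ m + 1 := by omega
  have e0 : (n + 1) * (m + 1) * M ≤ W := by
    rw [hW]
    gcongr <;> exact Nat.le_self_pow two_ne_zero _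
  have e1 : n + 1 ≤ (n + 1) * (m + 1) * M := by
    calc n + 1 = (n + 1) * 1 * 1 := by ring
      _ ≤ _ := by gcongr
  have e2 : m + 1 ≤ (n + 1) * (m + 1) * M := by
    calc m + 1 = 1 * (m + 1) * 1 := by ring
      _ ≤ _ := by gcongr
  have e3 : M ≤ (n + 1) * (m + 1) * M := by
    calc M = 1 * 1 * M := by ring
      _ ≤ _ := by gcongr
  have e4 : m * n ≤ (n + 1) * (m + 1) * M := by
    calc m * n ≤ (m + 1) * (n + 1) * 1 := by rw [mul_one]; gcongr <;> omega
      _ ≤ (n + 1) * (m + 1) * M := by rw [mul_comm (m + 1)]; gcongr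
  have e5 : M * n ≤ (n + 1) * (m + 1) * M := by
    calc M * n ≤ M * (n + 1) * 1 := by rw [mul_one]; gcongr; omega
      _ ≤ M * (n + 1) * (m + 1) := by gcongr
      _ = _ := by ring
  have hB : 2 ^ 6 * (n + 1) ^ 2 * (m + 1) * M ^ 2 = 64 * W := by rw [hW]; ring
  have hR : 2 ^ 8 * (n + 1) ^ 2 * (m + 1) * M ^ 2 = 256 * W := by rw [hW]; ring
  rw [hB]
  rw [hR] at h
  generalize (n + 1) * (m + 1) * M = V at *
  refine ⟨?_, ?_, ?_, ?_, ?_, ?_, ?_, hMA.le⟩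
  all_goals try omega
  rw [add_mul, one_mul]
  omega

theorem mainTheorem10 :
    ∃ (P : WordRAM.Prog) (C : ℕ), ∀ (m n : ℕ) (A : Matrix (Fin m) (Fin n) ℤ),
      ∃ X : Set (Fin n → ℤ),
        (∀ x ∈ X, ∀ j, x j = 0 ∨ x j = 1) ∧
        (∀ w : ℕ, powBound C m n (maxAbsEntry A) ≤ 2 ^ w →
          ∃ (s : WordRAM.State) (t : ℕ),
            WordRAM.Exec w P (WordRAM.input A) s t ∧
            t ≤ powBound C m n (maxAbsEntry A) ∧
            WordRAM.Outputs s X) ∧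
        (∀ b : Fin m → ℤ,
          (∃ x : Fin n → ℕ, A.mulVec (fun j => (x j : ℤ)) = b) →
          ∃ y : Fin n → ℕ,
            A.mulVec (fun j => (y j : ℤ)) = b ∧
            suppVec y ∈ X ∧
            ((vecSupp y).card : ℝ) ≤ m * Real.logb 2 (2 * n * maxAbsEntry A + 1)) := by
  refine ⟨supportProg, 19, fun m n A => ⟨{x | x ∈ stage A n}, zeroOne_stage A n, ?_, ?_⟩⟩
  · intro w hw
    have h := resourceBound_le_powBound m n (maxAbsEntry A)
    obtain ⟨s, t, he, ht, ho⟩ := runs_supportProg (fits_of_resourceBound_le A (h.trans hw))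
    exact ⟨s, t, he, ht.trans ((supportTime_le (Nat.one_le_pow _ _ (by omega))).trans h), ho⟩
  · rintro b ⟨x, rfl⟩
    exact exists_solution A x
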